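/- Conventions. An upho lattice is a lattice $\mathcal{L}$ with at least two elements such that every principal order filter $\{q \in \mathcal{L} : q \ge p\}$ is isomorphic to $\mathcal{L}$, and which is finite type $\mathbb{N}$-graded: it has a minimum $\hat 0$ and a rank function $\rho\colon \mathcal{L} \to \mathbb{N}$ such that every maximal chain has the form $\hat 0 = x_0 \lessdot x_1 \lessdot x_2 \lessdot \cdots$ with $\rho(x_i) = i$, and there are finitely many elements of each rank. Its core is the interval from $\hat 0$ to the join of its atoms. For a finite graded poset $P$ with rank function $\rho$ and Möbius function $\mu$, put $\chi^*(P;x) = \sum_{p \in P} \mu(\hat 0,p)\,x^{\rho(p)}$ (the reciprocal characteristic polynomial). The bond lattice $L(G)$ of a connected graph $G$ is the set of those partitions of the vertex set all of whose blocks induce connected subgraphs of $G$, ordered by refinement. Proposition. Let $G$ be the graph on the vertices $0,1,\dots,15$ with the $23$ edges $\{0,1\},\{0,2\}$; $\{2j-1,2j\}$ for $1 \le j \le 7$; $\{2j-1,2j+1\}$ and $\{2j,2j+2\}$ for $1 \le j \le 6$; and $\{13,15\},\{14,15\}$ (a strip of six squares with a triangle attached at each end). Then its bond lattice $L(G)$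 is a finite graded lattice of rank $15$, and: 1. $\chi^*(L(G);x) = (1-x)(1-2x)^2(1-3x+3x^2)^6$. 2. All coefficients of the formal power series $\chi^*(L(G);x)^{-1}$ are positive. 3. The coefficient of $x^{24}$ in the formal power series $\chi^*(L(G);x^2)/\chi^*(L(G);x)^2$ is $-269758375958758$; in particular it is negative. 4. $L(G)$ is not (isomorphic to) the core of any upho lattice. -/

import Mathlib

open Polynomial

universe u

/-! ### Graded posets -/

/-- `ρ` is the rank function of an `ℕ`-graded poset with infinite maximal chains: every maximal
chain has the form `0̂ = x₀ ⋖ x₁ ⋖ x₂ ⋖ ⋯` with `ρ (xᵢ) = i`. (Maximal chains exist, so this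
includes that there is a minimum. The degree-`i` piece is `Pᵢ = {p | ρ p = i}`.) -/
def IsNatGradedBy (P : Type*) [PartialOrder P] (ρ : P → ℕ) : Prop :=
  ∀ C : Set P, IsMaxChain (· ≤ ·) C →
    ∃ x : ℕ → P, C = Set.range x ∧ IsBot (x 0) ∧ (∀ i, x i ⋖ x (i + 1)) ∧ ∀ i, ρ (x i) = i

/-- `ρ` is the rank function of an `n`-graded poset: every maximal chain has the form
`0̂ = x₀ ⋖ x₁ ⋖ ⋯ ⋖ xₙ = 1̂` with `ρ (xᵢ) = i`. -/
def IsGradedBy (P : Type*) [PartialOrder P] (n : ℕ) (ρ : P → ℕ) : Prop :=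
  ∀ C : Set P, IsMaxChain (· ≤ ·) C →
    ∃ x : ℕ → P, C = x '' Set.Iic n ∧ IsBot (x 0) ∧ IsTop (x n) ∧
      (∀ i < n, x i ⋖ x (i + 1)) ∧ ∀ i ≤ n, ρ (x i) = i

/-- The reciprocal characteristic polynomial `χ*(P; x) = ∑ p, μ(0̂, p) x ^ ρ(p)` of a finite poset
`P` with minimum `0̂ = ⊥` and rank function `ρ`; `μ` is the Möbius function. -/
noncomputable def reciprocalCharPoly (P : Type*) [PartialOrder P] [OrderBot P] [Fintype P]
    [LocallyFiniteOrder P] [DecidableEq P] (ρ : P → ℕ) : ℤ[X] :=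
  ∑ p : P, C (IncidenceAlgebra.mu ℤ (⊥ : P) p) * X ^ ρ p

/-! ### Upho lattices and their cores -/

/-- A (finite type `ℕ`-graded) upho lattice: a lattice with at least two elements in which every
principal order filter is isomorphic to the whole, and which is `ℕ`-graded with finitely many
elements of each rank. -/
structure IsUphoLattice (𝓛 : Type*) [Lattice 𝓛] : Prop where
  nontrivial : Nontrivial 𝓛
  upperHomogeneous : ∀ p : 𝓛, Nonempty (Set.Ici p ≃o 𝓛)
  finiteTypeGraded : ∃ ρ : 𝓛 → ℕ, IsNatGradedBy 𝓛 ρ ∧ ∀ i : ℕ, {p : 𝓛 | ρ p = i}.Finite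

/-- `L` is (isomorphic to) the core of `𝓛`, i.e. to the interval from the minimum to the join
of the atoms. -/
def IsCoreOf (L : Type*) [PartialOrder L] (𝓛 : Type*) [Lattice 𝓛] [OrderBot 𝓛] : Prop :=
  ∃ c : 𝓛, IsLUB {s : 𝓛 | IsAtom s} c ∧ Nonempty (L ≃o Set.Icc (⊥ : 𝓛) c)

/-! ### Bond lattices -/

/-- The bond lattice of a graph `G`: the partitions of the vertex set all of whose blocks induce
connected subgraphs, ordered by refinement. Partitions are given by their equivalence relations,
for which `r ≤ s` says that `r` refines `s`, and `r.classes` is the set of blocks. -/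
def BondLattice {V : Type*} (G : SimpleGraph V) : Type _ :=
  {r : Setoid V // ∀ B ∈ r.classes, (G.induce B).Connected}

namespace BondLattice

variable {V : Type*} (G : SimpleGraph V)

instance : PartialOrder (BondLattice G) :=
  inferInstanceAs (PartialOrder {r : Setoid V // ∀ B ∈ r.classes, (G.induce B).Connected})

/-- The minimum is the partition into singletons. -/
instance : OrderBot (BondLattice G) where
  bot := ⟨⊥, by
    rintro B ⟨y, rfl⟩
    have : Subsingleton ↑{x | (⊥ : Setoid V) x y} :=
      ⟨fun a b => Subtype.ext (a.2.trans b.2.symm)⟩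
    have : Nonempty ↑{x | (⊥ : Setoid V) x y} := ⟨⟨y, rfl⟩⟩
    exact ⟨SimpleGraph.Preconnected.of_subsingleton⟩⟩
  bot_le r := (bot_le : (⊥ : Setoid V) ≤ r.1)

instance [Finite V] : Finite (BondLattice G) := by
  have : Finite (Setoid V) :=
    Finite.of_injective (fun r : Setoid V => fun x y => r x y)
      (fun r s h => Setoid.ext fun a b => iff_of_eq (congrFun (congrFun h a) b))
  exact Subtype.finite

noncomputable instance [Finite V] : Fintype (BondLattice G) := Fintype.ofFinite _

noncomputable instance : DecidableEq (BondLattice G) := Classical.decEq _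

open Classical in
noncomputable instance [Finite V] : LocallyFiniteOrder (BondLattice G) :=
  Fintype.toLocallyFiniteOrder

end BondLattice

/-! ### The graph -/

/-- A strip of six squares with a triangle attached at each end. In the plane, vertex `0` is at
`(0, 0)`, the vertices `2 j - 1` and `2 j` are at `(j, 1/2)` and `(j, -1/2)` for `1 ≤ j ≤ 7`, and
vertex `15` is at `(8, 0)`. -/
def ladderGraph : SimpleGraph (Fin 16) :=
  SimpleGraph.fromEdgeSet
    {s(0, 1), s(0, 2), s(1, 2),
     s(1, 3), s(2, 4), s(3, 4),
     s(3, 5), s(4, 6), s(5, 6),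
     s(5, 7), s(6, 8), s(7, 8),
     s(7, 9), s(8, 10), s(9, 10),
     s(9, 11), s(10, 12), s(11, 12),
     s(11, 13), s(12, 14), s(13, 14),
     s(13, 15), s(14, 15)}

/-!
The theorem rests on one computation, performed twice: a sum of Möbius values `μ(⊥, p)` over the
elements `p` of a finite lattice below a given element is `1` or `0` according to whether that
element is `⊥`.

*The characteristic polynomial.* Every equivalence relation `r` on the vertices has a coarsest
refinement in the bond lattice (`BondLattice.interior`). Sorting the colorings by the
interior of their kernel, the Möbius sum `∑ π, μ(⊥, π) n ^ (number of blocks of π)` retains exactly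
the proper colorings (`BondLattice.sum_mu_mul_card_pow`). For the strip of squares these are counted
square by square: each square multiplies their number by `n² - 3 n + 3`, whatever the colors on the
side already colored, and the closing triangle by `n - 2` (`ladderGraph.card_proper`). Evaluating at
`1 / n` yields `χ*` (`ladderGraph.reciprocalCharPoly_eq`).

*Upho lattices.* Let `L` be the core of an upho lattice `𝓛` with rank generating function `F`. The
principal filter above `p` has generating function `x ^ ρ(p) F`, so `χ*(L; x) F` is the sum over all
`q` in `𝓛` of `x ^ ρ(q) ∑ μ(⊥, p)`, the inner sum being over the `p` in `L` below `q`. It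
detects whether the meet of `q` with the join of the atoms is `⊥`, that is, whether `q = ⊥`; hence
`χ*(L; x) F = 1`. Applied to pairs `(q, r)`, the same computation shows that `χ*(L; x²) F²` counts
the pairs with meet `⊥` by total rank (`coeff_reciprocalCharPoly_comp_mul_sq_nonneg`). A
negative coefficient of this series therefore excludes `L` as a core (`not_isCoreOf_of_coeff_neg`).

*The power series.* For positivity, `1 - 3 x + 3 x²` divides `1 + 27 x⁶`, hence `1 - 729 x¹²`, whose
inverse has nonnegative coefficients. What remains of `1 / χ*` after taking out
`1 / (1 - 729 x¹²) ^ 6` is the quotient of a polynomial by `(1 - x) (1 - 2 x)²`, which is expanded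
explicitly (`ladderGraph.numerator_identity`) and exceeds `1 / (1 - x)` coefficientwise. The
coefficient of `x²⁴` is read off from an explicit expansion (`ladderGraph.quotient_identity`).
-/

/-! ### Partitions into connected blocks -/

namespace BondLattice

variable {V : Type*} {G : SimpleGraph V}

/-- The partition of `V` into the connected components of the graph whose edges are the edges of
`G` that join two vertices in the same class of `r`. It is the coarsest member of the bond lattice
that refines `r`. -/
def bondKernel (G : SimpleGraph V) (r : Setoid V) : Setoid V :=
  Relation.EqvGen.setoid fun a b => G.Adj a b ∧ r a b

theorem bondKernel_le (r : Setoid V) : bondKernel G r ≤ r :=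
  Setoid.eqvGen_le fun _ _ h => h.2

theorem bondKernel_rel {r : Setoid V} {a b : V} (hab : G.Adj a b) (hr : r a b) :
    bondKernel G r a b :=
  Relation.EqvGen.rel _ _ ⟨hab, hr⟩

theorem bondKernel_mono {r s : Setoid V} (h : r ≤ s) : bondKernel G r ≤ bondKernel G s :=
  Setoid.eqvGen_le fun _ _ hab => bondKernel_rel hab.1 (h hab.2)

/-- Membership in the bond lattice in terms of the relation alone: any two vertices of a class are
joined by a path inside it. -/
theorem forall_classes_connected_iff {r : Setoid V} :
    (∀ B ∈ r.classes, (G.induce B).Connected) ↔ r ≤ bondKernel G r := by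
  constructor
  · intro h x y hxy
    have hc := (h _ (Setoid.mem_classes r y)).preconnected ⟨x, hxy⟩ ⟨y, r.refl y⟩
    rw [SimpleGraph.reachable_iff_reflTransGen] at hc
    have key : ∀ z : {z // r z y},
        Relation.ReflTransGen (G.induce {z | r z y}).Adj ⟨x, hxy⟩ z →
          bondKernel G r x z := by
      intro z hz
      induction hz with
      | refl => exact Setoid.refl' _ _
      | @tail b c _ hbc ih =>
        exact Setoid.trans' _ ih (bondKernel_rel hbc (r.trans b.2 (r.symm c.2)))
    exact key _ hc
  · rintro h _ ⟨y, rfl⟩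
    have key : ∀ a b, Relation.EqvGen (fun a b => G.Adj a b ∧ r a b) a b →
        ∀ (ha : r a y) (hb : r b y), (G.induce {z | r z y}).Reachable ⟨a, ha⟩ ⟨b, hb⟩ := by
      intro a b hab
      induction hab with
      | rel a b hab =>
        intro ha hb
        exact SimpleGraph.Adj.reachable (G := G.induce {z | r z y})
          (u := ⟨a, ha⟩) (v := ⟨b, hb⟩) hab.1
      | refl a => intro _ _; exact SimpleGraph.Reachable.refl _
      | symm a b _ ih => intro ha hb; exact (ih hb ha).symm
      | trans a b c _ hbc ih₁ ih₂ =>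
        intro ha hc
        have hb : r b y := r.trans (bondKernel_le (G := G) r hbc) hc
        exact (ih₁ ha hb).trans (ih₂ hb hc)
    have : Nonempty ↑{z | r z y} := ⟨⟨y, r.refl y⟩⟩
    exact ⟨fun a b => key _ _ (h (r.trans a.2 (r.symm b.2))) a.2 b.2⟩

theorem le_bondKernel (π : BondLattice G) : π.1 ≤ bondKernel G π.1 :=
  forall_classes_connected_iff.1 π.2

theorem bondKernel_le_bondKernel_self (r : Setoid V) :
    bondKernel G r ≤ bondKernel G (bondKernel G r) :=
  Setoid.eqvGen_le fun _ _ h => bondKernel_rel h.1 (bondKernel_rel h.1 h.2)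

/-- The coarsest member of the bond lattice that refines `r`. -/
def interior (G : SimpleGraph V) (r : Setoid V) : BondLattice G :=
  ⟨bondKernel G r, forall_classes_connected_iff.2 (bondKernel_le_bondKernel_self r)⟩

theorem le_interior_iff {π : BondLattice G} {r : Setoid V} : π ≤ interior G r ↔ π.1 ≤ r :=
  ⟨fun h => le_trans (b := bondKernel G r) h (bondKernel_le r),
    fun h => (le_bondKernel π).trans (bondKernel_mono h)⟩

theorem exists_isLUB_pair (π σ : BondLattice G) : ∃ z, IsLUB {π, σ} z := by
  refine ⟨⟨π.1 ⊔ σ.1, forall_classes_connected_iff.2 (sup_le ?_ ?_)⟩, ?_, ?_⟩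
  · exact (le_bondKernel π).trans (bondKernel_mono le_sup_left)
  · exact (le_bondKernel σ).trans (bondKernel_mono le_sup_right)
  · rintro τ (rfl | rfl)
    · exact (le_sup_left : τ.1 ≤ _)
    · exact (le_sup_right : τ.1 ≤ _)
  · intro τ hτ
    exact (sup_le (hτ (Or.inl rfl)) (hτ (Or.inr rfl)) : π.1 ⊔ σ.1 ≤ τ.1)

theorem exists_isGLB_pair (π σ : BondLattice G) : ∃ z, IsGLB {π, σ} z := by
  refine ⟨interior G (π.1 ⊓ σ.1), ?_, ?_⟩
  · have h := le_interior_iff.1 (le_refl (interior G (π.1 ⊓ σ.1)))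
    rintro τ (rfl | rfl)
    · exact h.trans inf_le_left
    · exact h.trans inf_le_right
  · intro τ hτ
    exact le_interior_iff.2 (le_inf (hτ (Or.inl rfl)) (hτ (Or.inr rfl)))

/-- The number of vertices minus the number of blocks. -/
noncomputable def rank (π : BondLattice G) : ℕ := Nat.card V - Nat.card (Quotient π.1)

section Finite

variable [Finite V]

theorem card_quotient_le (r : Setoid V) : Nat.card (Quotient r) ≤ Nat.card V :=
  Nat.card_le_card_of_surjective _ Quotient.mk_surjective

theorem card_quotient_lt {r s : Setoid V} (h : r < s) :
    Nat.card (Quotient s) < Nat.card (Quotient r) := by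
  by_contra! hc
  let f : Quotient r → Quotient s := Quotient.map' id fun _ _ hab => h.le hab
  have hf : Function.Surjective f := by
    intro y
    induction y using Quotient.inductionOn with
    | _ y => exact ⟨Quotient.mk r y, rfl⟩
  have hb := hf.bijective_of_nat_card_le hc
  refine h.not_ge fun a b hab => ?_
  exact Quotient.exact (hb.1 (a₁ := Quotient.mk r a) (a₂ := Quotient.mk r b) (Quotient.sound hab))

theorem rank_strictMono : StrictMono (rank : BondLattice G → ℕ) := by
  intro π σ h
  have h1 := card_quotient_lt (r := π.1) (s := σ.1) h
  have h2 := card_quotient_le π.1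
  unfold rank
  omega

/-- Between two comparable members of the bond lattice there is a step of rank one: merge two blocks
of the finer partition that are joined by an edge lying inside a block of the coarser one. -/
theorem exists_rank_succ {π σ : BondLattice G} (h : π < σ) :
    ∃ τ, π < τ ∧ τ ≤ σ ∧ τ.rank = π.rank + 1 := by
  obtain ⟨a, b, hab, hs, hr⟩ : ∃ a b, G.Adj a b ∧ σ.1 a b ∧ ¬ π.1 a b := by
    by_contra! hc
    refine h.not_ge ?_
    exact (le_bondKernel σ).trans (Setoid.eqvGen_le fun a b hab => hc a b hab.1 hab.2)
  classical
  let g : V → Quotient π.1 := fun x => if π.1 x b then Quotient.mk _ a else Quotient.mk _ x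
  have hgb : ∀ x, π.1 x b → g x = Quotient.mk _ a := fun x hx => if_pos hx
  have hgn : ∀ x, ¬ π.1 x b → g x = Quotient.mk _ x := fun x hx => if_neg hx
  have hle : π.1 ≤ Setoid.ker g := by
    intro x y hxy
    change g x = g y
    by_cases hx : π.1 x b
    · rw [hgb x hx, hgb y (π.1.trans (π.1.symm hxy) hx)]
    · rw [hgn x hx, hgn y fun hy => hx (π.1.trans hxy hy)]
      exact Quotient.sound hxy
  have hker : bondKernel G π.1 ≤ bondKernel G (Setoid.ker g) := bondKernel_mono hle
  have hπ : ∀ {x y}, π.1 x y → bondKernel G (Setoid.ker g) x y :=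
    fun hxy => hker (le_bondKernel π hxy)
  have hgab : g a = g b := by rw [hgn a hr, hgb b (π.1.refl b)]
  have habk : bondKernel G (Setoid.ker g) a b := bondKernel_rel hab hgab
  -- Every vertex can be moved inside the kernel to a representative of its value under `g`.
  have hrep : ∀ x y, g x = Quotient.mk _ y → bondKernel G (Setoid.ker g) x y := by
    intro x y hxy
    by_cases hx : π.1 x b
    · rw [hgb x hx] at hxy
      exact Setoid.trans' _ (hπ hx)
        (Setoid.trans' _ (Setoid.symm' _ habk) (hπ (Quotient.exact hxy)))
    · rw [hgn x hx] at hxy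
      exact hπ (Quotient.exact hxy)
  have hbond : Setoid.ker g ≤ bondKernel G (Setoid.ker g) := by
    intro x y hxy
    obtain ⟨z, hz⟩ := Quotient.exists_rep (g x)
    exact Setoid.trans' _ (hrep x z hz.symm)
      (Setoid.symm' _ (hrep y z ((show g x = g y from hxy) ▸ hz.symm)))
  refine ⟨⟨Setoid.ker g, forall_classes_connected_iff.2 hbond⟩, ?_, ?_, ?_⟩
  · refine lt_of_le_not_ge hle fun hge => hr ?_
    exact hge (show (Setoid.ker g) a b from hgab)
  · refine le_trans (b := bondKernel G (Setoid.ker g)) hbond (Setoid.eqvGen_le fun x y hxy => ?_)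
    have hσ : ∀ z w, g z = Quotient.mk _ w → σ.1 z w := by
      intro z w hzw
      by_cases hz : π.1 z b
      · rw [hgb z hz] at hzw
        exact σ.1.trans (h.le hz) (σ.1.trans (σ.1.symm hs) (h.le (Quotient.exact hzw)))
      · rw [hgn z hz] at hzw
        exact h.le (Quotient.exact hzw)
    obtain ⟨z, hz⟩ := Quotient.exists_rep (g x)
    exact σ.1.trans (hσ x z hz.symm) (σ.1.symm (hσ y z ((show g x = g y from hxy.2) ▸ hz.symm)))
  · have hrange : Set.range g = {Quotient.mk _ b}ᶜ := by
      ext q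
      constructor
      · rintro ⟨x, rfl⟩ hx
        by_cases hxb : π.1 x b
        · rw [hgb x hxb] at hx
          exact hr (Quotient.exact hx)
        · rw [hgn x hxb] at hx
          exact hxb (Quotient.exact hx)
      · intro hq
        obtain ⟨x, rfl⟩ := Quotient.exists_rep q
        exact ⟨x, hgn x fun hx => hq (Quotient.sound hx)⟩
    have hcard : Nat.card (Quotient (Setoid.ker g)) + 1 = Nat.card (Quotient π.1) := by
      rw [Nat.card_congr (Setoid.quotientKerEquivRange g), Nat.card_coe_set_eq, hrange]
      have := Set.ncard_add_ncard_compl {Quotient.mk π.1 b}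
      rw [Set.ncard_singleton] at this
      omega
    have := card_quotient_le π.1
    unfold rank
    change Nat.card V - Nat.card (Quotient (Setoid.ker g)) = _
    omega

end Finite

theorem rank_bot : rank (⊥ : BondLattice G) = 0 := by
  have : Nat.card (Quotient (⊥ : Setoid V)) = Nat.card V :=
    Nat.card_congr Setoid.quotientBotEquiv 
  unfold rank
  change Nat.card V - Nat.card (Quotient (⊥ : Setoid V)) = 0
  omega

end BondLattice

/-! ### Gradedness of bond lattices -/

/-- A poset with minimum and maximum carrying a strictly monotone function that starts at `0`, ends
at `n`, and can always be raised in steps of one, is graded of rank `n`. -/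
theorem isGradedBy_of_exists_succ {P : Type*} [PartialOrder P] {n : ℕ} {ρ : P → ℕ} {b t : P}
    (hb : IsBot b) (ht : IsTop t) (hρb : ρ b = 0) (hρt : ρ t = n) (hmono : StrictMono ρ)
    (hstep : ∀ x y, x < y → ∃ z, x < z ∧ z ≤ y ∧ ρ z = ρ x + 1) : IsGradedBy P n ρ := by
  intro C hC
  -- By maximality, the chain contains every element comparable to all of its members.
  have hins : ∀ z, (∀ y ∈ C, y ≤ z ∨ z ≤ y) → z ∈ C := by
    intro z hz
    have : IsChain (· ≤ ·) (insert z C) :=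
      hC.1.insert fun y hy _ => (hz y hy).symm
    rw [hC.2 this (Set.subset_insert z C)]
    exact Set.mem_insert z C
  have hex : ∀ i ≤ n, ∃ x ∈ C, ρ x = i := by
    intro i
    induction i with
    | zero => exact fun _ => ⟨b, hins b fun y _ => Or.inr (hb y), hρb⟩
    | succ i ih =>
      intro hi
      obtain ⟨x, hx, rfl⟩ := ih (by omega)
      have hxt : x < t := lt_of_le_of_ne (ht x) (by rintro rfl; omega)
      have hne : {y | y ∈ C ∧ x < y}.Nonempty := ⟨t, hins t fun y _ => Or.inl (ht y), hxt⟩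
      -- `y` is the next element of the chain after `x`.
      obtain ⟨y, ⟨hy, hxy⟩, hmin⟩ : ∃ y ∈ {y | y ∈ C ∧ x < y},
          ∀ z ∈ {y | y ∈ C ∧ x < y}, ρ y ≤ ρ z :=
        ⟨_, Function.argminOn_mem ρ _ hne, fun z hz => Function.argminOn_le ρ _ hz⟩
      obtain ⟨z, hxz, hzy, hz⟩ := hstep x y hxy
      refine ⟨z, hins z fun w hw => ?_, hz⟩
      by_cases hxw : x < w
      · right
        rcases hC.1.total hy hw with hyw | hwy
        · exact hzy.trans hyw
        · rcases hwy.eq_or_lt with rfl | hlt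
          · exact hzy
          · exact absurd (hmin w ⟨hw, hxw⟩) (not_le.2 (hmono hlt))
      · left
        rcases hC.1.total hx hw with hxw' | hwx
        · rcases hxw'.eq_or_lt with rfl | hlt
          · exact hxz.le
          · exact absurd hlt hxw
        · exact hwx.trans hxz.le
  have huniq : ∀ x ∈ C, ∀ y ∈ C, ρ x ≤ ρ y → x ≤ y := by
    intro x hx y hy hxy
    rcases hC.1.total hx hy with h | h
    · exact h
    · rcases h.eq_or_lt with rfl | h
      · exact le_rfl
      · exact absurd (hmono h) (not_lt.2 hxy)
  have : Nonempty P := ⟨b⟩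
  choose! x hxC hxρ using hex
  refine ⟨x, ?_, ?_, ?_, ?_, hxρ⟩
  · ext z
    constructor
    · intro hz
      have hzn : ρ z ≤ n := hρt ▸ hmono.monotone (ht z)
      exact ⟨ρ z, hzn, le_antisymm (huniq _ (hxC _ hzn) _ hz (hxρ _ hzn).le)
        (huniq _ hz _ (hxC _ hzn) (hxρ _ hzn).ge)⟩
    · rintro ⟨i, hi, rfl⟩
      exact hxC i hi
  · intro y
    have h0 : x 0 ≤ b := huniq _ (hxC 0 n.zero_le) _ (hins b fun y _ => Or.inr (hb y))
      (by rw [hxρ 0 n.zero_le]; omega)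
    exact h0.trans (hb y)
  · intro y
    have h0 : t ≤ x n := huniq _ (hins t fun y _ => Or.inl (ht y)) _ (hxC n le_rfl)
      (by rw [hxρ n le_rfl, hρt])
    exact (ht y).trans h0
  · intro i hi
    have h1 := hxρ i hi.le
    have h2 := hxρ (i + 1) hi
    refine ⟨lt_of_le_of_ne (huniq _ (hxC i hi.le) _ (hxC _ hi) (by omega)) ?_, ?_⟩
    · intro he
      rw [he] at h1
      omega
    · intro z hz hz'
      have := hmono hz
      have := hmono hz'
      omega

namespace BondLattice

/-- The bond lattice of a connected finite graph is graded, of rank one less than the number of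
vertices. -/
theorem isGradedBy_rank {V : Type*} [Finite V] {G : SimpleGraph V} (hG : G.Connected) :
    IsGradedBy (BondLattice G) (Nat.card V - 1) rank := by
  have htop : (⊤ : Setoid V) ≤ bondKernel G ⊤ := by
    rintro x y -
    have h := hG.preconnected x y
    rw [SimpleGraph.reachable_iff_reflTransGen] at h
    induction h with
    | refl => exact Setoid.refl' _ _
    | tail _ hbc ih => exact Setoid.trans' _ ih (bondKernel_rel hbc trivial)
  refine isGradedBy_of_exists_succ (b := ⊥)
    (t := ⟨⊤, forall_classes_connected_iff.2 htop⟩) (fun x => bot_le)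
    (fun x => (le_top : x.1 ≤ ⊤)) rank_bot ?_ rank_strictMono fun _ _ => exists_rank_succ
  have : Nat.card (Quotient (⊤ : Setoid V)) = 1 := by
    have : Nonempty (Quotient (⊤ : Setoid V)) := hG.nonempty.map (Quotient.mk _)
    rw [Nat.card_eq_one_iff_unique]
    exact ⟨⟨fun a b => Quotient.inductionOn₂ a b fun _ _ => Quotient.sound trivial⟩, this⟩
  unfold rank
  rw [this]

end BondLattice

/-! ### Upho lattices and their cores -/

section Rank

variable {P : Type*} [PartialOrder P]

theorem exists_maxChain_superset {x y : P} (h : x ≤ y) :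
    ∃ C : Set P, IsMaxChain (· ≤ ·) C ∧ x ∈ C ∧ y ∈ C := by
  obtain ⟨C, hC, hs⟩ := (IsChain.pair (r := (· ≤ ·)) h).exists_maxChain
  exact ⟨C, hC, hs (by simp), hs (by simp)⟩

theorem Set.OrdConnected.covBy_coe {s : Set P} (hs : s.OrdConnected) {x y : s} (h : x ⋖ y) :
    (x : P) ⋖ y :=
  ⟨h.1, fun z hxz hzy => h.2 (c := ⟨z, hs.out x.2 y.2 ⟨hxz.le, hzy.le⟩⟩) hxz hzy⟩

/-- `ρ` is compatible with covers: it starts at `0`, every cover raises it by one, and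
every element is reached from the minimum by finitely many covers. -/
structure IsCoverRank [OrderBot P] (ρ : P → ℕ) : Prop where
  bot : ρ ⊥ = 0
  covBy : ∀ x y, x ⋖ y → ρ y = ρ x + 1
  reach : ∀ x : P, Relation.ReflTransGen (· ⋖ ·) ⊥ x

/-- Such a function is unique. -/
theorem IsCoverRank.eq [OrderBot P] {ρ σ : P → ℕ} (hρ : IsCoverRank ρ) (h0 : σ ⊥ = 0)
    (hσ : ∀ x y, x ⋖ y → σ y = σ x + 1) (x : P) : ρ x = σ x := by
  induction hρ.reach x with
  | refl => rw [hρ.bot, h0]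
  | tail _ hbc ih => rw [hρ.covBy _ _ hbc, hσ _ _ hbc, ih]

/-- It suffices that any two comparable elements lie on a saturated chain from the minimum along
which `ρ` is the index. -/
theorem isCoverRank_of_chains [OrderBot P] {ρ : P → ℕ}
    (h : ∀ x y : P, x ≤ y → ∃ (c : ℕ → P) (i j : ℕ), i ≤ j ∧ c i = x ∧ c j = y ∧ IsBot (c 0) ∧
      (∀ k < j, c k ⋖ c (k + 1)) ∧ ∀ k ≤ j, ρ (c k) = k) : IsCoverRank ρ where
  bot := by
    obtain ⟨c, i, j, -, -, -, h0, -, hρ⟩ := h ⊥ ⊥ le_rfl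
    have : c 0 = ⊥ := le_bot_iff.1 (h0 ⊥)
    rw [← this]
    exact hρ 0 j.zero_le
  covBy x y hxy := by
    obtain ⟨c, i, j, hij, rfl, rfl, -, hc, hρ⟩ := h x y hxy.le
    rw [hρ i hij, hρ j le_rfl]
    have hlt : i < j := lt_of_le_of_ne hij (by rintro rfl; exact hxy.lt.false)
    -- If `j ≠ i + 1`, then `c (i + 1)` lies strictly between `x` and `y`.
    by_contra hne
    have hmono : ∀ k, i + 1 + k ≤ j → c (i + 1) ≤ c (i + 1 + k) := by
      intro k
      induction k with
      | zero => exact fun _ => le_rfl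
      | succ k ih => exact fun hk => (ih (by omega)).trans (hc (i + 1 + k) (by omega)).le
    have hle : c (i + 1) ≤ c j := by
      have := hmono (j - (i + 1)) (by omega)
      rwa [show i + 1 + (j - (i + 1)) = j by omega] at this
    have hne' : c (i + 1) ≠ c j := by
      intro he
      have := congrArg ρ he
      rw [hρ _ hlt, hρ _ le_rfl] at this
      omega
    exact hxy.2 (hc i hlt).lt (lt_of_le_of_ne hle hne')
  reach x := by
    obtain ⟨c, i, j, -, -, rfl, h0, hc, -⟩ := h ⊥ x bot_le
    have hmain : ∀ k ≤ j, Relation.ReflTransGen (· ⋖ ·) ⊥ (c k) := by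
      intro k
      induction k with
      | zero => rw [le_bot_iff.1 (h0 ⊥)]; exact fun _ => .refl
      | succ k ih => exact fun hk => (ih (by omega)).tail (hc k (by omega))
    exact hmain j le_rfl

theorem IsNatGradedBy.isCoverRank [OrderBot P] {ρ : P → ℕ} (h : IsNatGradedBy P ρ) :
    IsCoverRank ρ := by
  refine isCoverRank_of_chains fun x y hxy => ?_
  obtain ⟨C, hC, hx, hy⟩ := exists_maxChain_superset hxy
  obtain ⟨c, rfl, h0, hc, hρ⟩ := h C hC
  obtain ⟨i, rfl⟩ := hx
  obtain ⟨j, rfl⟩ := hy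
  have hmono : StrictMono c := strictMono_nat_of_lt_succ fun k => (hc k).lt
  exact ⟨c, i, j, hmono.le_iff_le.1 hxy, rfl, rfl, h0, fun k _ => hc k, fun k _ => hρ k⟩

theorem IsGradedBy.isCoverRank [OrderBot P] {n : ℕ} {ρ : P → ℕ} (h : IsGradedBy P n ρ) :
    IsCoverRank ρ := by
  refine isCoverRank_of_chains fun x y hxy => ?_
  obtain ⟨C, hC, hx, hy⟩ := exists_maxChain_superset hxy
  obtain ⟨c, rfl, h0, -, hc, hρ⟩ := h C hC
  obtain ⟨i, hi, rfl⟩ := hx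
  obtain ⟨j, hj, rfl⟩ := hy
  rw [Set.mem_Iic] at hi hj
  have hmono : ∀ k m, m + k ≤ n → c m ≤ c (m + k) := by
    intro k m
    induction k with
    | zero => exact fun _ => le_rfl
    | succ k ih => exact fun hk => (ih (by omega)).trans (hc (m + k) (by omega)).le
  rcases le_total i j with hij | hij
  · exact ⟨c, i, j, hij, rfl, rfl, h0, fun k hk => hc k (by omega), fun k hk => hρ k (by omega)⟩
  · have : c i = c j := by
      refine hxy.antisymm ?_
      have := hmono (i - j) j (by omega)
      rwa [show j + (i - j) = i by omega] at this
    exact ⟨c, j, j, le_rfl, this.symm, rfl, h0, fun k hk => hc k (by omega),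
      fun k hk => hρ k (by omega)⟩

/-- Ranks in an upper interval are shifted by the rank of its minimum. -/
theorem IsCoverRank.orderIso_Ici [OrderBot P] {ρ : P → ℕ} (hρ : IsCoverRank ρ) {p : P}
    (e : Set.Ici p ≃o P) (q : Set.Ici p) : ρ q = ρ (e q) + ρ p := by
  suffices h : ∀ x, ρ (e.symm x) = ρ x + ρ p by simpa using h (e q)
  intro x
  induction hρ.reach x with
  | refl =>
    have : e.symm ⊥ = ⟨p, le_rfl⟩ :=
      le_antisymm (e.symm_apply_le.2 bot_le) (Subtype.coe_le_coe.1 (e.symm ⊥).2)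
    rw [this, hρ.bot, zero_add]
  | tail _ hbc ih =>
    have hcov := Set.ordConnected_Ici.covBy_coe ((apply_covBy_apply_iff e.symm).2 hbc)
    rw [hρ.covBy _ _ hcov, hρ.covBy _ _ hbc, ih, add_right_comm]

/-- Ranks in a lower interval agree with the ranks in the whole poset. -/
theorem IsCoverRank.orderIso_Icc [OrderBot P] {ρ : P → ℕ} (hρ : IsCoverRank ρ) {c : P}
    {L : Type*} [PartialOrder L] [OrderBot L] {σ : L → ℕ} (hσ : IsCoverRank σ)
    (e : L ≃o Set.Icc (⊥ : P) c) (x : L) : ρ (e x) = σ x := by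
  refine (hσ.eq (σ := fun x => ρ (e x)) ?_ (fun x y hxy => hρ.covBy _ _ ?_) x).symm
  · have : (e ⊥ : P) = ⊥ := by
      have h : e ⊥ ≤ ⟨⊥, le_rfl, bot_le.trans (e ⊥).2.2⟩ := e.le_symm_apply.1 bot_le
      exact le_bot_iff.1 h
    change ρ (e ⊥ : P) = 0
    rw [this, hρ.bot]
  · exact Set.ordConnected_Icc.covBy_coe ((apply_covBy_apply_iff e).2 hxy)

theorem IsCoverRank.exists_isAtom_le [OrderBot P] {ρ : P → ℕ} (hρ : IsCoverRank ρ) {q : P}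
    (hq : q ≠ ⊥) : ∃ a, IsAtom a ∧ a ≤ q := by
  rcases (hρ.reach q).cases_head with h | ⟨a, ha, haq⟩
  · exact absurd h.symm hq
  · refine ⟨a, bot_covBy_iff.1 ha, ?_⟩
    clear ha hq
    induction haq with
    | refl => exact le_rfl
    | tail _ hbc ih => exact ih.trans hbc.le

end Rank

section Core

variable {L : Type*} [PartialOrder L] [OrderBot L] [Fintype L] [LocallyFiniteOrder L]
  [DecidableEq L] {𝓛 : Type*} [Lattice 𝓛] [OrderBot 𝓛]

open Classical in
/-- Möbius inversion in the core: an element `q` of the big lattice is `⊥` exactly if its meet with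
the join `c` of the atoms is, and the elements of the core below `q` are those below `q ⊓ c`. -/
theorem sum_mu_core {ρ : 𝓛 → ℕ} (hρ : IsCoverRank ρ) {c : 𝓛} (hc : IsLUB {s : 𝓛 | IsAtom s} c)
    (e : L ≃o Set.Icc (⊥ : 𝓛) c) (q : 𝓛) :
    ∑ p : L, (if (e p : 𝓛) ≤ q then IncidenceAlgebra.mu ℤ (⊥ : L) p else 0)
      = if q = ⊥ then 1 else 0 := by
  have hqc : q ⊓ c ∈ Set.Icc ⊥ c := ⟨bot_le, inf_le_right⟩
  have hset : Finset.univ.filter (fun p : L => (e p : 𝓛) ≤ q)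
      = Finset.Icc ⊥ (e.symm ⟨q ⊓ c, hqc⟩) := by
    ext p
    simp only [Finset.mem_filter, Finset.mem_univ, true_and, Finset.mem_Icc, bot_le,
      e.le_symm_apply]
    exact ⟨fun h => (le_inf h (e p).2.2 : (e p : 𝓛) ≤ q ⊓ c),
      fun h => le_trans (b := q ⊓ c) h inf_le_left⟩
  have hbc : (⊥ : 𝓛) ∈ Set.Icc ⊥ c := ⟨le_rfl, bot_le⟩
  have hbot : e ⊥ = ⟨⊥, hbc⟩ :=
    le_antisymm (e.le_symm_apply.1 bot_le) (Subtype.coe_le_coe.1 bot_le)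
  rw [← Finset.sum_filter, hset, IncidenceAlgebra.sum_Icc_mu_right]
  refine if_congr ?_ rfl rfl
  rw [eq_comm, e.symm_apply_eq, hbot, Subtype.mk_eq_mk]
  constructor
  · intro h
    by_contra hq
    obtain ⟨a, ha, haq⟩ := hρ.exists_isAtom_le hq
    exact ha.1 (le_bot_iff.1 (h ▸ le_inf haq (hc.1 ha)))
  · rintro rfl
    exact bot_inf_eq _

variable {ρ : 𝓛 → ℕ} (hfin : ∀ i : ℕ, {p : 𝓛 | ρ p = i}.Finite)

open Classical in
/-- The rank generating function of the principal filter above `p`, ranks being taken in the whole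
lattice. -/
noncomputable def filterSeries (hfin : ∀ i : ℕ, {p : 𝓛 | ρ p = i}.Finite) (p : 𝓛) :
    PowerSeries ℤ :=
  PowerSeries.mk fun k => ∑ q ∈ (hfin k).toFinset, if p ≤ q then 1 else 0

/-- By upper homogeneity, principal filters have the generating function of the whole lattice, up to
the shift of ranks. -/
theorem filterSeries_eq (hρ : IsCoverRank ρ) (hu : ∀ p : 𝓛, Nonempty (Set.Ici p ≃o 𝓛)) (p : 𝓛) :
    filterSeries hfin p = PowerSeries.X ^ ρ p * filterSeries hfin ⊥ := by
  classical
  obtain ⟨e⟩ := hu p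
  have hrank := hρ.orderIso_Ici e
  ext k
  rw [PowerSeries.coeff_X_pow_mul', filterSeries, PowerSeries.coeff_mk, ← Finset.sum_filter]
  split_ifs with hk
  · simp only [filterSeries, PowerSeries.coeff_mk, bot_le, if_true, Finset.sum_const,
      nsmul_eq_mul, mul_one, Nat.cast_inj]
    refine Finset.card_bij' (fun q hq => e ⟨q, (Finset.mem_filter.1 hq).2⟩)
      (fun q _ => (e.symm q : 𝓛)) ?_ ?_ ?_ ?_
    · intro q hq
      have h1 := hrank ⟨q, (Finset.mem_filter.1 hq).2⟩
      have h2 : ρ q = k := by simpa using (Finset.mem_filter.1 hq).1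
      simp only [Set.Finite.mem_toFinset, Set.mem_ofPred_eq]
      simp only at h1
      omega
    · intro q hq
      have h1 := hrank (e.symm q)
      rw [e.apply_symm_apply] at h1
      have h2 : ρ q = k - ρ p := by simpa using hq
      have h3 : p ≤ (e.symm q : 𝓛) := (e.symm q).2
      simp only [Finset.mem_filter, Set.Finite.mem_toFinset, Set.mem_ofPred_eq]
      exact ⟨by omega, h3⟩
    · intro q hq
      exact congrArg Subtype.val (e.symm_apply_apply ⟨q, (Finset.mem_filter.1 hq).2⟩)
    · intro q hq
      exact e.apply_symm_apply q
  · refine Finset.sum_eq_zero fun q hq => absurd ?_ hk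
    obtain ⟨h1, h2⟩ := Finset.mem_filter.1 hq
    have h3 := hrank ⟨q, h2⟩
    have h4 : ρ q = k := by simpa using h1
    simp only at h3
    omega

theorem coe_reciprocalCharPoly (σ : L → ℕ) :
    (reciprocalCharPoly L σ : PowerSeries ℤ)
      = ∑ p : L, PowerSeries.C (IncidenceAlgebra.mu ℤ (⊥ : L) p) * PowerSeries.X ^ σ p := by
  rw [reciprocalCharPoly, ← Polynomial.coeToPowerSeries.ringHom_apply, map_sum]
  simp only [Polynomial.coeToPowerSeries.ringHom_apply, coe_mul, coe_C, coe_pow, coe_X]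

theorem coe_reciprocalCharPoly_comp (σ : L → ℕ) :
    (((reciprocalCharPoly L σ).comp (X ^ 2) : ℤ[X]) : PowerSeries ℤ)
      = ∑ p : L, PowerSeries.C (IncidenceAlgebra.mu ℤ (⊥ : L) p) *
          (PowerSeries.X ^ σ p * PowerSeries.X ^ σ p) := by
  have h : (reciprocalCharPoly L σ).comp (X ^ 2)
      = ∑ p : L, C (IncidenceAlgebra.mu ℤ (⊥ : L) p) * (X ^ σ p * X ^ σ p) := by
    simp only [reciprocalCharPoly, Polynomial.sum_comp, mul_comp, C_comp, pow_comp, X_comp]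
    refine Finset.sum_congr rfl fun p _ => ?_
    ring
  rw [h, ← Polynomial.coeToPowerSeries.ringHom_apply, map_sum]
  simp only [Polynomial.coeToPowerSeries.ringHom_apply, coe_mul, coe_C, coe_pow, coe_X]

/-- The rank generating function of an upho lattice is the inverse of the reciprocal
characteristic polynomial of its core. -/
theorem reciprocalCharPoly_mul_filterSeries (hρ : IsCoverRank ρ)
    (hu : ∀ p : 𝓛, Nonempty (Set.Ici p ≃o 𝓛)) {σ : L → ℕ} (hσ : IsCoverRank σ)
    {c : 𝓛} (hc : IsLUB {s : 𝓛 | IsAtom s} c) (e : L ≃o Set.Icc (⊥ : 𝓛) c) :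
    (reciprocalCharPoly L σ : PowerSeries ℤ) * filterSeries hfin ⊥ = 1 := by
  classical
  have h : (reciprocalCharPoly L σ : PowerSeries ℤ) * filterSeries hfin ⊥
      = ∑ p : L, PowerSeries.C (IncidenceAlgebra.mu ℤ (⊥ : L) p) * filterSeries hfin (e p : 𝓛) := by
    rw [coe_reciprocalCharPoly, Finset.sum_mul]
    refine Finset.sum_congr rfl fun p _ => ?_
    rw [filterSeries_eq hfin hρ hu (e p : 𝓛), hρ.orderIso_Icc hσ, mul_assoc]
  ext k
  rw [h, map_sum]
  simp only [PowerSeries.coeff_C_mul, filterSeries, PowerSeries.coeff_mk, Finset.mul_sum]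
  rw [Finset.sum_comm]
  simp only [mul_ite, mul_one, mul_zero, sum_mu_core hρ hc e]
  rw [PowerSeries.coeff_one, Finset.sum_ite_eq']
  refine if_congr ?_ rfl rfl
  simp [hρ.bot, eq_comm]

/-- The coefficients of `χ*(x²) F(x)²` count the pairs of elements with meet `⊥`, by total
rank: the inner sum over the core detects whether the meet of the pair is `⊥`. -/
theorem coeff_reciprocalCharPoly_comp_mul_sq_nonneg (hρ : IsCoverRank ρ)
    (hu : ∀ p : 𝓛, Nonempty (Set.Ici p ≃o 𝓛)) {σ : L → ℕ} (hσ : IsCoverRank σ)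
    {c : 𝓛} (hc : IsLUB {s : 𝓛 | IsAtom s} c) (e : L ≃o Set.Icc (⊥ : 𝓛) c) (k : ℕ) :
    0 ≤ PowerSeries.coeff k
      (((reciprocalCharPoly L σ).comp (X ^ 2) : ℤ[X]) *
        filterSeries hfin ⊥ ^ 2 : PowerSeries ℤ) := by
  classical
  have h : (((reciprocalCharPoly L σ).comp (X ^ 2) : ℤ[X]) *
        filterSeries hfin ⊥ ^ 2 : PowerSeries ℤ)
      = ∑ p : L, PowerSeries.C (IncidenceAlgebra.mu ℤ (⊥ : L) p) *
          (filterSeries hfin (e p : 𝓛) * filterSeries hfin (e p : 𝓛)) := by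
    rw [coe_reciprocalCharPoly_comp, Finset.sum_mul]
    refine Finset.sum_congr rfl fun p _ => ?_
    rw [filterSeries_eq hfin hρ hu (e p : 𝓛), hρ.orderIso_Icc hσ]
    ring
  rw [h, map_sum]
  simp only [PowerSeries.coeff_C_mul]
  simp only [PowerSeries.coeff_mul, filterSeries, PowerSeries.coeff_mk,
    Finset.mul_sum, Finset.sum_mul]
  rw [Finset.sum_comm]
  refine Finset.sum_nonneg fun ij _ => ?_
  rw [Finset.sum_comm]
  refine Finset.sum_nonneg fun q _ => ?_
  rw [Finset.sum_comm]
  refine Finset.sum_nonneg fun r _ => ?_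
  have hpair : ∀ p : L, IncidenceAlgebra.mu ℤ (⊥ : L) p *
      ((if (e p : 𝓛) ≤ r then 1 else 0) * (if (e p : 𝓛) ≤ q then 1 else 0))
      = if (e p : 𝓛) ≤ q ⊓ r then IncidenceAlgebra.mu ℤ (⊥ : L) p else 0 := by
    intro p
    by_cases h1 : (e p : 𝓛) ≤ q <;> by_cases h2 : (e p : 𝓛) ≤ r <;> simp [h1, h2]
  simp only [hpair, sum_mu_core hρ hc e]
  split_ifs <;> norm_num

/-- If `F = 1 / χ*(L; x)` and some coefficient of `χ*(L; x²) F²` is negative, then `L` is not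
the core of an upho lattice. -/
theorem not_isCoreOf_of_coeff_neg {n : ℕ} {σ : L → ℕ} (hσ : IsGradedBy L n σ) {F : PowerSeries ℤ}
    (hF : (reciprocalCharPoly L σ : PowerSeries ℤ) * F = 1) {k : ℕ}
    (hk : PowerSeries.coeff k
      (((reciprocalCharPoly L σ).comp (X ^ 2) : ℤ[X]) * F ^ 2 : PowerSeries ℤ) < 0)
    (h𝓛 : IsUphoLattice 𝓛) : ¬ IsCoreOf L 𝓛 := by
  rintro ⟨c, hc, ⟨e⟩⟩
  obtain ⟨ρ, hρ, hfin⟩ := h𝓛.finiteTypeGraded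
  have hF' := reciprocalCharPoly_mul_filterSeries hfin hρ.isCoverRank h𝓛.upperHomogeneous
    hσ.isCoverRank hc e
  have : F = filterSeries hfin ⊥ := by
    rw [mul_comm] at hF
    calc F = F * (reciprocalCharPoly L σ * filterSeries hfin ⊥) := by rw [hF', mul_one]
      _ = filterSeries hfin ⊥ := by rw [← mul_assoc, hF, one_mul]
  rw [this] at hk
  exact hk.not_ge (coeff_reciprocalCharPoly_comp_mul_sq_nonneg hfin hρ.isCoverRank
    h𝓛.upperHomogeneous hσ.isCoverRank hc e k)

end Core

/-! ### The chromatic polynomial -/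

namespace BondLattice

variable {V : Type*} {G : SimpleGraph V}

theorem interior_ker_eq_bot_iff {α : Type*} {f : V → α} :
    (⊥ : BondLattice G) = interior G (Setoid.ker f) ↔ ∀ a b, G.Adj a b → f a ≠ f b := by
  constructor
  · intro h a b hab hf
    have hk : (interior G (Setoid.ker f)).1 a b := bondKernel_rel hab hf
    rw [← h] at hk
    exact hab.ne hk
  · intro h
    refine (le_bot_iff.1 ?_).symm
    exact Setoid.eqvGen_le (s := ⊥) fun a b hab => (h a b hab.1 hab.2).elim

variable [Fintype V]

open Classical in
/-- The chromatic polynomial as a Möbius sum over the bond lattice. Among the colorings constant on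
the blocks of `π`, sorted by the coarsest bond partition on whose blocks they are constant, the
Möbius function retains those for which this partition is `⊥`, that is, the proper ones. -/
theorem sum_mu_mul_card_pow (α : Type*) [Fintype α] :
    ∑ π : BondLattice G, IncidenceAlgebra.mu ℤ ⊥ π *
      (Fintype.card α : ℤ) ^ Nat.card (Quotient π.1) =
    Nat.card {f : V → α // ∀ a b, G.Adj a b → f a ≠ f b} := by
  have hcard : ∀ π : BondLattice G, (Fintype.card α : ℤ) ^ Nat.card (Quotient π.1) =
      ∑ f : V → α, if π.1 ≤ Setoid.ker f then 1 else 0 := by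
    intro π
    rw [Finset.sum_boole, ← Fintype.card_subtype, Fintype.card_congr (Setoid.liftEquiv π.1),
      Fintype.card_fun, Nat.cast_pow, Nat.card_eq_fintype_card]
  simp only [hcard, Finset.mul_sum, mul_ite, mul_one, mul_zero]
  rw [Finset.sum_comm, Nat.card_eq_fintype_card, Fintype.card_subtype, ← Finset.sum_boole]
  refine Finset.sum_congr rfl fun f _ => ?_
  have hset : Finset.univ.filter (fun π : BondLattice G => π.1 ≤ Setoid.ker f)
      = Finset.Icc ⊥ (interior G (Setoid.ker f)) := by
    ext π
    simp [le_interior_iff]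
  rw [← Finset.sum_filter, hset, IncidenceAlgebra.sum_Icc_mu_right]
  exact if_congr interior_ker_eq_bot_iff rfl rfl

open Classical in
/-- At `1 / n`, the reciprocal characteristic polynomial counts proper colorings with `n` colors. -/
theorem pow_mul_eval_reciprocalCharPoly (n : ℕ) (hn : n ≠ 0) :
    (n : ℚ) ^ Fintype.card V *
      ((reciprocalCharPoly (BondLattice G) rank).map (Int.castRingHom ℚ)).eval (1 / (n : ℚ)) =
    Nat.card {f : V → Fin n // ∀ a b, G.Adj a b → f a ≠ f b} := by
  have h := sum_mu_mul_card_pow (G := G) (Fin n)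
  rw [Fintype.card_fin] at h
  rw [← Int.cast_natCast (R := ℚ) (Nat.card _), ← h, reciprocalCharPoly, Polynomial.map_sum,
    eval_finsetSum, Finset.mul_sum, Int.cast_sum]
  refine Finset.sum_congr rfl fun π _ => ?_
  have hπ := card_quotient_le π.1
  have hpow : (n : ℚ) ^ Fintype.card V =
      (n : ℚ) ^ rank π * (n : ℚ) ^ Nat.card (Quotient π.1) := by
    rw [← pow_add, ← Nat.card_eq_fintype_card, rank, Nat.sub_add_cancel hπ]
  have hn' : (n : ℚ) ≠ 0 := Nat.cast_ne_zero.2 hn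
  simp only [Polynomial.map_mul, map_C, Polynomial.map_pow, map_X, eval_mul, eval_C, eval_pow,
    eval_X, Int.cast_mul, Int.cast_pow, Int.cast_natCast]
  rw [hpow, eq_intCast, one_div, inv_pow]
  field_simp

end BondLattice

/-! ### The colorings of the strip of squares -/

namespace ladderGraph

/-- The indicator of `a ≠ b`. -/
def neInd {α : Type*} [DecidableEq α] (a b : α) : ℤ := if a = b then 0 else 1

/-- The edges of the graph, as a finset, for decidability. -/
def edges : Finset (Sym2 (Fin 16)) :=
  {s(0, 1), s(0, 2), s(1, 2),
    s(1, 3), s(2, 4), s(3, 4),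
    s(3, 5), s(4, 6), s(5, 6),
    s(5, 7), s(6, 8), s(7, 8),
    s(7, 9), s(8, 10), s(9, 10),
    s(9, 11), s(10, 12), s(11, 12),
    s(11, 13), s(12, 14), s(13, 14),
    s(13, 15), s(14, 15)}

theorem adj_iff {a b : Fin 16} : ladderGraph.Adj a b ↔ s(a, b) ∈ edges := by
  have hne : s(a, b) ∈ edges → a ≠ b := by
    rintro h rfl
    revert a
    decide
  rw [ladderGraph, SimpleGraph.fromEdgeSet_adj, ← and_iff_left_of_imp hne]
  simp only [edges, Finset.mem_insert, Finset.mem_singleton, Set.mem_insert_iff,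
    Set.mem_singleton_iff]

instance : DecidableRel ladderGraph.Adj := fun _ _ => decidable_of_iff' _ adj_iff

theorem connected : ladderGraph.Connected := by
  have h : ∀ v : Fin 16, v ≠ 0 → ∃ w, w < v ∧ ladderGraph.Adj w v := by decide
  have h0 : ∀ v : Fin 16, ladderGraph.Reachable 0 v := by
    intro v
    induction v using WellFoundedLT.induction with
    | _ v ih =>
      by_cases hv : v = 0
      · rw [hv]
      · obtain ⟨w, hw, hadj⟩ := h v hv
        exact (ih w hw).trans hadj.reachable
  exact ⟨fun v w => (h0 v).symm.trans (h0 w)⟩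

theorem isProper_iff {α : Type*} (f : Fin 16 → α) :
    (∀ a b, ladderGraph.Adj a b → f a ≠ f b) ↔
      f 0 ≠ f 1 ∧ f 0 ≠ f 2 ∧ f 1 ≠ f 2 ∧
      f 1 ≠ f 3 ∧ f 2 ≠ f 4 ∧ f 3 ≠ f 4 ∧
      f 3 ≠ f 5 ∧ f 4 ≠ f 6 ∧ f 5 ≠ f 6 ∧
      f 5 ≠ f 7 ∧ f 6 ≠ f 8 ∧ f 7 ≠ f 8 ∧
      f 7 ≠ f 9 ∧ f 8 ≠ f 10 ∧ f 9 ≠ f 10 ∧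
      f 9 ≠ f 11 ∧ f 10 ≠ f 12 ∧ f 11 ≠ f 12 ∧
      f 11 ≠ f 13 ∧ f 12 ≠ f 14 ∧ f 13 ≠ f 14 ∧
      f 13 ≠ f 15 ∧ f 14 ≠ f 15 := by
  constructor
  · intro h
    refine ⟨?_, ?_, ?_, ?_, ?_, ?_, ?_, ?_, ?_, ?_, ?_, ?_, ?_, ?_, ?_, ?_, ?_, ?_, ?_, ?_, ?_,
      ?_, ?_⟩ <;> exact h _ _ (by decide)
  · rintro ⟨h1, h2, h3, h4, h5, h6, h7, h8, h9, h10, h11, h12, h13, h14, h15, h16, h17, h18, h19,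
      h20, h21, h22, h23⟩ a b hab
    rw [ladderGraph, SimpleGraph.fromEdgeSet_adj] at hab
    simp only [Set.mem_insert_iff, Set.mem_singleton_iff] at hab
    replace hab := hab.1
    rcases hab with H | H | H | H | H | H | H | H | H | H | H | H | H | H | H | H | H | H | H | H |
      H | H | H <;> obtain ⟨rfl, rfl⟩ | ⟨rfl, rfl⟩ := Sym2.eq_iff.1 H <;>
      first | assumption | (apply Ne.symm; assumption)

section Count

variable {α : Type*} [Fintype α]

theorem sum_fin_succ_fun {n : ℕ} (g : (Fin (n + 1) → α) → ℤ) :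
    ∑ f, g f = ∑ a, ∑ f : Fin n → α, g (Matrix.vecCons a f) := by
  rw [← (Fin.consEquiv fun _ => α).sum_comp, Fintype.sum_prod_type]
  rfl

variable [DecidableEq α]

theorem sum_neInd_mul_neInd (a b : α) :
    neInd a b * ∑ c, neInd a c * neInd b c = neInd a b * (Fintype.card α - 2) := by
  by_cases hab : a = b
  · simp [neInd, hab]
  congr 1
  have h : ∀ c, neInd a c * neInd b c
      = 1 - (if a = c then 1 else 0) - (if b = c then 1 else 0) := by
    intro c
    unfold neInd
    split_ifs with h1 h2 <;> simp
    exact hab (h1.trans h2.symm)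
  simp only [h, Finset.sum_sub_distrib, Finset.sum_ite_eq, Finset.mem_univ, if_true,
    Finset.sum_const, Finset.card_univ, nsmul_eq_mul, mul_one]
  ring

/-- Number of ways to color the two new corners of a square whose other side has colors `a ≠ b`. -/
theorem sum_square (a b : α) :
    neInd a b * ∑ c, ∑ d, neInd a c * (neInd b d * neInd c d) =
      neInd a b * ((Fintype.card α : ℤ) ^ 2 - 3 * Fintype.card α + 3) := by
  by_cases hab : a = b
  · simp [neInd, hab]
  congr 1
  -- The last term removes the choices with `c = d`.
  have h : ∀ c d, neInd a c * (neInd b d * neInd c d)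
      = (1 - (if a = c then 1 else 0)) * (1 - (if b = d then 1 else 0))
        - (neInd a c * neInd b c) * (if c = d then 1 else 0) := by
    intro c d
    unfold neInd
    by_cases h : c = d
    · subst h; by_cases h1 : a = c <;> by_cases h2 : b = c <;> simp [h1, h2]
    · by_cases h1 : a = c <;> by_cases h2 : b = d <;> simp [h, h1, h2]
  have h2 := sum_neInd_mul_neInd a b
  rw [neInd, if_neg hab, one_mul, one_mul] at h2
  simp only [h, Finset.sum_sub_distrib, ← Finset.mul_sum, ← Finset.sum_mul, Finset.sum_ite_eq,
    Finset.mem_univ, if_true, mul_one, h2, Finset.sum_const, Finset.card_univ, nsmul_eq_mul]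
  ring

/-- The number of ways to extend a coloring of one edge, with colors `a` and `b`, across a strip of
`k` squares closed by a triangle. -/
def stripCount : ℕ → α → α → ℤ
  | 0, a, b => ∑ c, neInd a c * neInd b c
  | k + 1, a, b => ∑ c, ∑ d, neInd a c * (neInd b d * (neInd c d * stripCount k c d))

theorem stripCount_eq (k : ℕ) (a b : α) :
    neInd a b * stripCount k a b = neInd a b *
      (((Fintype.card α : ℤ) ^ 2 - 3 * Fintype.card α + 3) ^ k * (Fintype.card α - 2)) := by
  induction k generalizing a b with
  | zero => simpa [stripCount] using sum_neInd_mul_neInd a b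
  | succ k ih =>
    simp only [stripCount, ih]
    simp only [← mul_assoc, ← Finset.sum_mul]
    have := sum_square a b
    simp only [← mul_assoc] at this
    rw [this]
    ring

/-- The first triangle is colored vertex by vertex; the remaining vertices then contribute factors
that do not depend on the colors chosen before. -/
theorem card_proper :
    (Nat.card {f : Fin 16 → α // ∀ a b, ladderGraph.Adj a b → f a ≠ f b} : ℤ) =
      Fintype.card α * (Fintype.card α - 1) * (Fintype.card α - 2) ^ 2 *
        ((Fintype.card α : ℤ) ^ 2 - 3 * Fintype.card α + 3) ^ 6 := by
  have hind : ∀ (a b : α) (p : Prop) [Decidable p],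
      (if a ≠ b ∧ p then (1 : ℤ) else 0) = neInd a b * if p then 1 else 0 := by
    intro a b p _
    by_cases h : a = b <;> simp [neInd, h]
  have hind' : ∀ (a b : α), (if a ≠ b then (1 : ℤ) else 0) = neInd a b := by
    intro a b
    by_cases h : a = b <;> simp [neInd, h]
  have hpeel : (Nat.card {f : Fin 16 → α // ∀ a b, ladderGraph.Adj a b → f a ≠ f b} : ℤ) =
      ∑ a : α, ∑ b, ∑ c, neInd a b * (neInd a c * (neInd b c * stripCount 6 b c)) := by
    rw [Nat.card_congr (Equiv.subtypeEquivRight isProper_iff), Nat.card_eq_fintype_card,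
      Fintype.card_subtype, ← Finset.sum_boole]
    simp only [hind, hind']
    -- Both sides are sums over the colors of the vertices in turn, and agree term by term.
    iterate 3 rw [sum_fin_succ_fun]; refine Finset.sum_congr rfl fun _ _ => ?_
    iterate 6
      rw [stripCount]
      simp only [Finset.mul_sum]
      iterate 2 rw [sum_fin_succ_fun]; refine Finset.sum_congr rfl fun _ _ => ?_
    rw [stripCount]
    simp only [Finset.mul_sum]
    rw [sum_fin_succ_fun]
    refine Finset.sum_congr rfl fun _ _ => ?_
    rw [Fintype.sum_unique]
    rfl
  have hone : ∀ a : α, ∑ b, neInd a b = Fintype.card α - 1 := by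
    intro a
    have : ∀ b, neInd a b = 1 - if a = b then 1 else 0 := by
      intro b
      unfold neInd
      split_ifs <;> rfl
    simp [this]
  have htri : ∀ a : α, ∑ b, neInd a b * ∑ c, neInd a c * neInd b c =
      (Fintype.card α - 1) * (Fintype.card α - 2) := by
    intro a
    simp only [sum_neInd_mul_neInd, ← Finset.sum_mul, hone]
  rw [hpeel]
  simp only [stripCount_eq]
  simp only [← mul_assoc, ← Finset.sum_mul]
  simp only [mul_assoc, ← Finset.mul_sum, htri]
  simp only [Finset.sum_const, Finset.card_univ, nsmul_eq_mul]
  ring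

end Count

theorem reciprocalCharPoly_eq :
    reciprocalCharPoly (BondLattice ladderGraph) BondLattice.rank =
      (1 - X) * (1 - 2 * X) ^ 2 * (1 - 3 * X + 3 * X ^ 2) ^ 6 := by
  -- Both sides agree at `1 / n` for all `n ≥ 1`.
  apply Polynomial.map_injective (Int.castRingHom ℚ) Int.cast_injective
  refine Polynomial.eq_of_infinite_eval_eq _ _ (Set.Infinite.mono ?_
    (Set.infinite_range_of_injective (f := fun n : ℕ => 1 / ((n + 1 : ℕ) : ℚ)) ?_))
  · rintro _ ⟨n, rfl⟩
    have hn : (((n + 1 : ℕ) : ℚ)) ≠ 0 := Nat.cast_ne_zero.2 n.succ_ne_zero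
    have h := BondLattice.pow_mul_eval_reciprocalCharPoly (G := ladderGraph) (n + 1) n.succ_ne_zero
    have hc := congrArg (Int.cast : ℤ → ℚ) (card_proper (α := Fin (n + 1)))
    rw [Int.cast_natCast] at hc
    rw [hc, Fintype.card_fin, Fintype.card_fin] at h
    simp only [Int.cast_mul, Int.cast_pow, Int.cast_sub, Int.cast_add, Int.cast_natCast,
      Int.cast_ofNat, Int.cast_one] at h
    clear hc
    change eval (1 / ((n + 1 : ℕ) : ℚ)) _ = eval (1 / ((n + 1 : ℕ) : ℚ)) _
    generalize ((n + 1 : ℕ) : ℚ) = m at *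
    have he : (m ^ 16) * (((1 - X) * (1 - 2 * X) ^ 2 * (1 - 3 * X + 3 * X ^ 2) ^ 6 : ℤ[X]).map
        (Int.castRingHom ℚ)).eval (1 / m) =
          m * (m - 1) * (m - 2) ^ 2 * (m ^ 2 - 3 * m + 3) ^ 6 := by
      simp
      field_simp
    exact mul_left_cancel₀ (pow_ne_zero 16 hn) (h.trans he.symm)
  · intro a b hab
    simpa using hab

end ladderGraph

/-! ### Power series -/

section Series

theorem PowerSeries.coeff_mul_nonneg {F G : PowerSeries ℤ} (hF : ∀ k, 0 ≤ PowerSeries.coeff k F)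
    (hG : ∀ k, 0 ≤ PowerSeries.coeff k G) (k : ℕ) : 0 ≤ PowerSeries.coeff k (F * G) := by
  rw [PowerSeries.coeff_mul]
  exact Finset.sum_nonneg fun ij _ => mul_nonneg (hF ij.1) (hG ij.2)

theorem PowerSeries.coeff_pow_nonneg {F : PowerSeries ℤ} (hF : ∀ k, 0 ≤ PowerSeries.coeff k F)
    (n k : ℕ) : 0 ≤ PowerSeries.coeff k (F ^ n) := by
  induction n generalizing k with
  | zero =>
    rw [pow_zero, PowerSeries.coeff_one]
    split_ifs <;> norm_num
  | succ n ih => exact pow_succ F n ▸ PowerSeries.coeff_mul_nonneg ih hF k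

/-- The geometric series `1 / (1 - a x ^ m)`. -/
theorem PowerSeries.exists_inv_one_sub (a : ℕ) {m : ℕ} (hm : m ≠ 0) :
    ∃ G : PowerSeries ℤ, (1 - (a : PowerSeries ℤ) * PowerSeries.X ^ m) * G = 1 ∧
      PowerSeries.constantCoeff G = 1 ∧ ∀ k, 0 ≤ PowerSeries.coeff k G := by
  set P : PowerSeries ℤ := 1 - (a : PowerSeries ℤ) * PowerSeries.X ^ m with hP
  have hPc : PowerSeries.constantCoeff P = ((1 : ℤˣ) : ℤ) := by simp [hP, hm]
  have hmul := PowerSeries.mul_invOfUnit P 1 hPc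
  refine ⟨PowerSeries.invOfUnit P 1, hmul, by simp, fun k => ?_⟩
  induction k using Nat.strong_induction_on with
  | _ k ih =>
    have hrec : PowerSeries.invOfUnit P 1
        = 1 + PowerSeries.C (a : ℤ) * (PowerSeries.X ^ m * PowerSeries.invOfUnit P 1) := by
      have : (PowerSeries.C (a : ℤ) : PowerSeries ℤ) = a := by simp
      rw [this]
      linear_combination hmul
    rw [hrec, map_add, PowerSeries.coeff_C_mul, PowerSeries.coeff_X_pow_mul', PowerSeries.coeff_one]
    have h1 : (0 : ℤ) ≤ if k = 0 then 1 else 0 := by split_ifs <;> norm_num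
    refine add_nonneg h1 (mul_nonneg (by positivity) ?_)
    split_ifs with hk
    · exact ih _ (by omega)
    · exact le_rfl

theorem PowerSeries.coeff_ofDigits_X_nonneg (l : List ℕ) (k : ℕ) :
    0 ≤ PowerSeries.coeff k (Nat.ofDigits (PowerSeries.X : PowerSeries ℤ) l) := by
  induction l generalizing k with
  | nil => simp [Nat.ofDigits]
  | cons a l ih =>
    rw [Nat.ofDigits, map_add]
    have ha : PowerSeries.coeff k (a : PowerSeries ℤ) = if k = 0 then (a : ℤ) else 0 := by
      rw [← PowerSeries.coeff_C, map_natCast PowerSeries.C]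
    cases k with
    | zero => simp
    | succ k =>
      rw [ha, PowerSeries.coeff_succ_X_mul]
      simpa using ih k

namespace ladderGraph

/-- The quotient of `((1 - 729 x ^ 12) / (1 - 3 x + 3 x ^ 2)) ^ 6` by `(1 - x) (1 - 2 x) ^ 2`, up to
degree `59` and with the rest in partial fractions. It exceeds `1 / (1 - x)`, which is split off as
the first summand, by a series without negative coefficients. -/
theorem numerator_identity {R : Type*} [CommRing R] (x : R) :
    ((1 + 3 * x + 6 * x ^ 2 + 9 * x ^ 3 + 9 * x ^ 4) * (1 - 27 * x ^ 6)) ^ 6 =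
    (1 - 2 * x) ^ 2 + (1 - x) * (1 - 2 * x) ^ 2 * Nat.ofDigits x
      [0, 22, 277, 2343, 15446, 84542, 398856, 1662580, 6229315, 21239073, 66486308, 192304478,
      516160671, 1288944691, 2997263479, 6484310871, 13011097247, 24068907431, 40620094767,
      61435770583, 80727193879, 87206203623, 71584354055, 59542611215, 204955715361,
      1005871470373, 3744768270259, 11307114690471, 29610063747797, 70022730917981,
      153517945742889, 318198906226969, 634024244047855, 1233483153894411, 2377485223907273,
      4597234281770021, 8995788794873151, 17878013641504975, 36046449001862791,
      73438824854962551, 150466470959113751, 308802445357715087, 633199850790357495,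
      1295689992927755887, 2645247941563429063, 5389858880763734439, 10966308881596336319,
      22291163932150446599, 45285393331546669716, 91968548920248981418, 186736370751876980101,
      379093840446977705967, 769476566916908598554, 1561604222602646840042,
      3168609454715061002148, 6428140898577993068584, 13038260638371952865515,
      26440622469523611762753, 53609594746885917962312, 108676037767075299739490] +
    x ^ 60 * (148863517207035903 * (1 - 2 * x) ^ 2 +
      217351777807116185407174 * ((1 - x) * (1 - 2 * x)) +
      2913994273641341701538 * (1 - x)) := by
  simp only [Nat.ofDigits, Nat.cast_ofNat, Nat.cast_zero]
  ring

/-- `1 / ((1 - x) (1 - 2 x) ^ 2 (1 - 3 x + 3 x ^ 2) ^ 6)` has positive coefficients: it is the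
product of `1 / (1 - 729 x ^ 12) ^ 6` and a series that exceeds `1 / (1 - x)`. -/
theorem coeff_inv_pos {F : PowerSeries ℤ}
    (hF : (1 - PowerSeries.X) * (1 - 2 * PowerSeries.X) ^ 2 *
      (1 - 3 * PowerSeries.X + 3 * PowerSeries.X ^ 2) ^ 6 * F = 1) (k : ℕ) :
    0 < PowerSeries.coeff k F := by
  obtain ⟨G₂, hG₂, -, hn₂⟩ := PowerSeries.exists_inv_one_sub 2 one_ne_zero
  obtain ⟨G₁₂, hG₁₂, hc₁₂, hn₁₂⟩ := PowerSeries.exists_inv_one_sub 729 (m := 12) (by norm_num)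
  have hid := numerator_identity (PowerSeries.X : PowerSeries ℤ)
  generalize hAeq : Nat.ofDigits (PowerSeries.X : PowerSeries ℤ) _ = A at hid
  have hA : ∀ k, 0 ≤ PowerSeries.coeff k A := hAeq ▸ PowerSeries.coeff_ofDigits_X_nonneg _
  clear hAeq
  set G₁ : PowerSeries ℤ := PowerSeries.mk 1 with hG₁def
  have hG₁ : (1 - PowerSeries.X) * G₁ = 1 := by
    rw [mul_comm]
    exact PowerSeries.mk_one_mul_one_sub_eq_one ℤ
  have hn₁ : ∀ k, 0 ≤ PowerSeries.coeff k G₁ := fun k => by simp [hG₁def]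
  set x : PowerSeries ℤ := PowerSeries.X with hx
  rw [pow_one, Nat.cast_ofNat] at hG₂
  rw [Nat.cast_ofNat] at hG₁₂
  set N : PowerSeries ℤ := A + x ^ 60 * (PowerSeries.C 148863517207035903 * G₁ +
    PowerSeries.C 217351777807116185407174 * G₂ +
    PowerSeries.C 2913994273641341701538 * G₂ ^ 2) with hN
  have hNnn : ∀ k, 0 ≤ PowerSeries.coeff k N := by
    intro k
    rw [hN, map_add, PowerSeries.coeff_X_pow_mul']
    refine add_nonneg (hA k) ?_
    split_ifs
    · rw [map_add, map_add, PowerSeries.coeff_C_mul, PowerSeries.coeff_C_mul,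
        PowerSeries.coeff_C_mul]
      have h1 := hn₁ (k - 60)
      have h2 := hn₂ (k - 60)
      have h3 := PowerSeries.coeff_pow_nonneg hn₂ 2 (k - 60)
      positivity
    · exact le_rfl
  have hFeq : F = (G₁ + N) * G₁₂ ^ 6 := by
    set q : PowerSeries ℤ := 1 - 3 * x + 3 * x ^ 2 with hq
    set M : PowerSeries ℤ := (1 + 3 * x + 6 * x ^ 2 + 9 * x ^ 3 + 9 * x ^ 4) * (1 - 27 * x ^ 6)
      with hM
    -- `1 + 27 x ^ 6 = (1 - 3 x + 3 x ^ 2) (1 + 3 x + 6 x ^ 2 + 9 x ^ 3 + 9 x ^ 4)`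
    have hqM : q * M = 1 - 729 * x ^ 12 := by rw [hq, hM]; ring
    have hNM : (1 - x) * (1 - 2 * x) ^ 2 * (G₁ + N) = M ^ 6 := by
      have ha : (PowerSeries.C 148863517207035903 : PowerSeries ℤ) = 148863517207035903 :=
        map_ofNat _ _
      have hb : (PowerSeries.C 217351777807116185407174 : PowerSeries ℤ) = 217351777807116185407174 :=
        map_ofNat _ _
      have hc : (PowerSeries.C 2913994273641341701538 : PowerSeries ℤ) = 2913994273641341701538 :=
        map_ofNat _ _
      rw [hid, hN, ha, hb, hc]
      linear_combination ((1 - 2 * x) ^ 2 + x ^ 60 * 148863517207035903 * (1 - 2 * x) ^ 2) * hG₁ +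
        x ^ 60 * 217351777807116185407174 * (1 - x) * (1 - 2 * x) * hG₂ +
        x ^ 60 * 2913994273641341701538 * (1 - x) * ((1 - 2 * x) * G₂ + 1) * hG₂
    calc F = ((q * M) * G₁₂) ^ 6 * F := by rw [hqM, hG₁₂, one_pow, one_mul]
      _ = q ^ 6 * M ^ 6 * G₁₂ ^ 6 * F := by ring
      _ = q ^ 6 * ((1 - x) * (1 - 2 * x) ^ 2 * (G₁ + N)) * G₁₂ ^ 6 * F := by rw [hNM]
      _ = ((1 - x) * (1 - 2 * x) ^ 2 * q ^ 6 * F) * ((G₁ + N) * G₁₂ ^ 6) := by ring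
      _ = (G₁ + N) * G₁₂ ^ 6 := by rw [hF, one_mul]
  have hn := PowerSeries.coeff_pow_nonneg hn₁₂ 6
  rw [hFeq, add_mul, map_add]
  refine add_pos_of_pos_of_nonneg ?_ (PowerSeries.coeff_mul_nonneg hNnn hn k)
  rw [PowerSeries.coeff_mul]
  have hle := Finset.single_le_sum
    (fun (ij : ℕ × ℕ) _ => mul_nonneg (hn₁ ij.1) (hn ij.2))
    ((Finset.HasAntidiagonal.mem_antidiagonal (a := (k, 0))).2 (add_zero k))
  have h0 : PowerSeries.coeff k G₁ * PowerSeries.coeff 0 (G₁₂ ^ 6) = 1 := by simp [hG₁def, hc₁₂]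
  exact lt_of_lt_of_le one_pos (h0.symm.le.trans hle)

/-- The expansion of `χ(x ^ 2) / χ(x) ^ 2` up to degree `24`. -/
theorem quotient_identity {R : Type*} [CommRing R] (x : R) :
    ((1 - x) * (1 - 2 * x) ^ 2 * (1 - 3 * x + 3 * x ^ 2) ^ 6) ^ 2 *
      (1 + 46 * x + 1062 * x ^ 2 + 16418 * x ^ 3 + 191298 * x ^ 4 + 1792510 * x ^ 5 + 14072126 * x
      ^ 6 + 95194270 * x ^ 7 + 566304726 * x ^ 8 + 3008154434 * x ^ 9 + 14435504958 * x ^ 10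
      + 63149149534 * x ^ 11 + 253588513826 * x ^ 12 + 939716989606 * x ^ 13 + 3225455707434
      * x ^ 14 + 10277856945530 * x ^ 15 + 30426910309686 * x ^ 16 + 83598775456366 * x ^ 17
      + 212437150287110 * x ^ 18 + 495770356617742 * x ^ 19 + 1048491794894814 * x ^ 20 +
      1957791692623394 * x ^ 21 + 3043461509068206 * x ^ 22 + 3268759441834798 * x ^ 23 -
      269758375958758 * x ^ 24) =
    (1 - x ^ 2) * (1 - 2 * x ^ 2) ^ 2 * (1 - 3 * x ^ 2 + 3 * x ^ 4) ^ 6 - x ^ 25 *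
      (-13072995905443658 + 561009252812918366 * x - 11692666571075829704 * x ^ 2 +
      157610297291974686312 * x ^ 3 - 1543538786023846771118 * x ^ 4 +
      11696681661078509446222 * x ^ 5 - 71319084210204209354736 * x ^ 6 +
      359226214392739745525184 * x ^ 7 - 1522695700936744558156548 * x ^ 8 +
      5505561609020555142118644 * x ^ 9 - 17149437490153714302738456 * x ^ 10 +
      46358466225005259743510088 * x ^ 11 - 109324113406916898046326102 * x ^ 12 +
      225710934316643982235775310 * x ^ 13 - 408832410073350553708247712 * x ^ 14 +
      650160177472622317336143984 * x ^ 15 - 907286575868931133956444948 * x ^ 16 +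
      1108954572809736458038925556 * x ^ 17 - 1183339244823995675492326296 * x ^ 18 +
      1097016868291222020957312456 * x ^ 19 - 877552404278233774776630174 * x ^ 20 +
      600189281086296755105904078 * x ^ 21 - 346641013376275546206757296 * x ^ 22 +
      166249959826977966628882368 * x ^ 23 - 64692575989829563525511490 * x ^ 24 +
      19756573831201560430127094 * x ^ 25 - 4502337022057615879047264 * x ^ 26 +
      704406826572922452919248 * x ^ 27 - 64494773820391997573856 * x ^ 28 +
      2293770577246372964448 * x ^ 29) := by
  ring

theorem coeff_quotient {F : PowerSeries ℤ}
    (hF : (1 - PowerSeries.X) * (1 - 2 * PowerSeries.X) ^ 2 *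
      (1 - 3 * PowerSeries.X + 3 * PowerSeries.X ^ 2) ^ 6 * F = 1) :
    PowerSeries.coeff 24 ((1 - PowerSeries.X ^ 2) * (1 - 2 * PowerSeries.X ^ 2) ^ 2 *
      (1 - 3 * PowerSeries.X ^ 2 + 3 * PowerSeries.X ^ 4) ^ 6 * F ^ 2) = -269758375958758 := by
  have hid := quotient_identity (PowerSeries.X : PowerSeries ℤ)
  -- A quotient known modulo `x ^ 25` has the right coefficient of `x ^ 24`.
  have hcut : ∀ {A B V W : PowerSeries ℤ}, A * F = 1 → A ^ 2 * V = B - PowerSeries.X ^ 25 * W →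
      PowerSeries.coeff 24 (B * F ^ 2) = PowerSeries.coeff 24 V := by
    intro A B V W hA hV
    have : B * F ^ 2 = V + PowerSeries.X ^ 25 * (W * F ^ 2) := by
      linear_combination -F ^ 2 * hV + V * (A * F + 1) * hA
    rw [this, map_add, PowerSeries.coeff_X_pow_mul']
    simp
  rw [hcut hF hid]
  simp only [map_add, map_sub]
  have h : ∀ (a : ℕ) [a.AtLeastTwo] (n : ℕ), PowerSeries.coeff 24
      ((OfNat.ofNat a : PowerSeries ℤ) * PowerSeries.X ^ n) =
        if 24 = n then OfNat.ofNat a else 0 := by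
    intro a _ n
    rw [← map_ofNat (PowerSeries.C (R := ℤ)) a, PowerSeries.coeff_C_mul, PowerSeries.coeff_X_pow]
    simp
  have h1 : PowerSeries.coeff 24 (46 * (PowerSeries.X : PowerSeries ℤ)) = 0 := by
    simpa using h 46 1
  simp only [PowerSeries.coeff_one, h, h1]
  simp

end ladderGraph

end Series

/-! ### The bond lattice of the strip -/

theorem mainTheorem12 :
    -- The bond lattice is a lattice,
    (∀ x y : BondLattice ladderGraph,
      (∃ z, IsLUB {x, y} z) ∧ (∃ z, IsGLB {x, y} z)) ∧
    -- it is graded of rank `15`; its reciprocal characteristic polynomial `χ*` is as given;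
    -- the inverse power series `F = 1 / χ*` has positive coefficients;
    -- the coefficient of `x ^ 24` in `χ*(x ^ 2) / χ*(x) ^ 2` is the given negative number,
    (∃ ρ : BondLattice ladderGraph → ℕ, IsGradedBy (BondLattice ladderGraph) 15 ρ ∧
      ∃ χ : ℤ[X], χ = reciprocalCharPoly (BondLattice ladderGraph) ρ ∧
        χ = (1 - X) * (1 - 2 * X) ^ 2 * (1 - 3 * X + 3 * X ^ 2) ^ 6 ∧
        ∃ F : PowerSeries ℤ, (χ : PowerSeries ℤ) * F = 1 ∧
          (∀ k : ℕ, 0 < PowerSeries.coeff k F) ∧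
          PowerSeries.coeff 24 ((χ.comp (X ^ 2) : ℤ[X]) * F ^ 2 : PowerSeries ℤ)
            = -269758375958758) ∧
    -- and the bond lattice is not the core of any upho lattice.
    (∀ (𝓛 : Type u) [Lattice 𝓛] [OrderBot 𝓛], IsUphoLattice 𝓛 →
      ¬ IsCoreOf (BondLattice ladderGraph) 𝓛) := by
  have hgraded : IsGradedBy (BondLattice ladderGraph) 15 BondLattice.rank := by
    simpa using BondLattice.isGradedBy_rank ladderGraph.connected
  have hχ := ladderGraph.reciprocalCharPoly_eq
  set χ := reciprocalCharPoly (BondLattice ladderGraph) BondLattice.rank with hχdef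
  have hcoe : (χ : PowerSeries ℤ) = (1 - PowerSeries.X) * (1 - 2 * PowerSeries.X) ^ 2 *
      (1 - 3 * PowerSeries.X + 3 * PowerSeries.X ^ 2) ^ 6 := by
    have h2 : ((2 : ℤ[X]) : PowerSeries ℤ) = 2 := map_ofNat Polynomial.coeToPowerSeries.ringHom 2
    have h3 : ((3 : ℤ[X]) : PowerSeries ℤ) = 3 := map_ofNat Polynomial.coeToPowerSeries.ringHom 3
    rw [hχ]
    simp [h2, h3]
  have hcomp : ((χ.comp (X ^ 2) : ℤ[X]) : PowerSeries ℤ) = (1 - PowerSeries.X ^ 2) *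
      (1 - 2 * PowerSeries.X ^ 2) ^ 2 *
      (1 - 3 * PowerSeries.X ^ 2 + 3 * PowerSeries.X ^ 4) ^ 6 := by
    have h2 : ((2 : ℤ[X]) : PowerSeries ℤ) = 2 := map_ofNat Polynomial.coeToPowerSeries.ringHom 2
    have h3 : ((3 : ℤ[X]) : PowerSeries ℤ) = 3 := map_ofNat Polynomial.coeToPowerSeries.ringHom 3
    rw [hχ]
    simp [h2, h3, ← pow_mul]
  obtain ⟨F, hF⟩ : ∃ F : PowerSeries ℤ, (χ : PowerSeries ℤ) * F = 1 :=
    ⟨_, PowerSeries.mul_invOfUnit _ 1 (by simp [hcoe])⟩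
  have hF' := hcoe ▸ hF
  have h24 : PowerSeries.coeff 24 ((χ.comp (X ^ 2) : ℤ[X]) * F ^ 2 : PowerSeries ℤ)
      = -269758375958758 := by
    rw [hcomp]
    exact ladderGraph.coeff_quotient hF'
  exact ⟨fun x y => ⟨BondLattice.exists_isLUB_pair x y, BondLattice.exists_isGLB_pair x y⟩,
    ⟨_, hgraded, χ, rfl, hχ, F, hF, ladderGraph.coeff_inv_pos hF', h24⟩,
    fun 𝓛 _ _ h𝓛 => not_isCoreOf_of_coeff_neg hgraded hF (h24.trans_lt (by norm_num)) h𝓛⟩
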